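/- For every natural number $N$ there exists a finite simple graph $G$ with $n \ge N$ vertices such that $G$ is 1-planar (that is, $G$ can be drawn in the plane such that every edge has at most one crossing), $G$ has minimum degree exactly $7$, and every matching of $G$ has at most $\frac{11n+12}{23}$ edges. -/

import Mathlib

/-- A (good) drawing of a simple graph in the plane: vertices are distinct points, every edge is a
simple arc joining the points of its two ends and passing through no other vertex, and two edges
with a common end meet in that end only. -/
structure PlaneDrawing {V : Type*} (G : SimpleGraph V) where
  /-- the point representing a vertex -/
  pos : V → ℝ × ℝ
  /-- the point set representing an edge (irrelevant for pairs that are not edges) -/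
  arc : Sym2 V → Set (ℝ × ℝ)
  pos_injective : Function.Injective pos
  arc_isSimple : ∀ u v : V, G.Adj u v →
    ∃ γ : Path (pos u) (pos v), Function.Injective γ ∧ Set.range γ = arc s(u, v)
  mem_of_pos_mem_arc : ∀ e ∈ G.edgeSet, ∀ w : V, pos w ∈ arc e → w ∈ e
  arc_inter_of_adjacent : ∀ e ∈ G.edgeSet, ∀ f ∈ G.edgeSet, e ≠ f →
    ∀ w : V, w ∈ e → w ∈ f → arc e ∩ arc f = {pos w}

/-- The crossings of the edge `e` in a drawing, as pairs of another edge `f` and a point common to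
`e` and `f` that is not a vertex. A point where `e` meets several other edges counts once for each
of them, and a point where `e` merely touches `f` is counted too. -/
def PlaneDrawing.crossings {V : Type*} {G : SimpleGraph V} (D : PlaneDrawing G) (e : Sym2 V) :
    Set (Sym2 V × (ℝ × ℝ)) :=
  {c | c.1 ∈ G.edgeSet ∧ c.1 ≠ e ∧ c.2 ∈ D.arc e ∧ c.2 ∈ D.arc c.1 ∧ c.2 ∉ Set.range D.pos}

/-- A graph is 1-planar if it can be drawn in the plane such that every edge has at most one
crossing. -/
def IsOnePlanar {V : Type*} (G : SimpleGraph V) : Prop :=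
  ∃ D : PlaneDrawing G, ∀ e ∈ G.edgeSet, (D.crossings e).Subsingleton

open SimpleGraph

/-! The extremal graph consists of `N + 1` copies of one 7-regular 1-planar graph on 24 vertices,
glued at a single vertex, so n = 23(N + 1) + 1. Deleting the shared vertex leaves components of odd
order 23. A matching has at most 11 edges in each, plus at most one edge at the shared vertex, hence
at most 11(N + 1) + 1 = (11n + 12)/23 edges (`ncard_edgeSet_le_of_isMatching_bouquet`).

For 1-planarity (`isOnePlanar_bouquet`), a straight-line drawing of one copy with the shared vertex
at the origin is sheared by (x, y) ↦ (x, y + ix) to give copy i. The sheared copies lie in sectors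
that meet only at the origin, and shears preserve orientations. Everything thus reduces to finite
integer checks on one drawing: no three vertices are collinear, and each edge properly crosses at
most one other. -/

/-! ### Planar orientation and segments -/

/-- Twice the signed area of the triangle `a b c`. -/
def orientation {R : Type*} [CommRing R] (a b c : R × R) : R :=
  (b.1 - a.1) * (c.2 - a.2) - (b.2 - a.2) * (c.1 - a.1)

lemma orientation_combo {a b c d : ℝ × ℝ} {s t : ℝ} (hst : s + t = 1) :
    orientation a b (s • c + t • d) = s * orientation a b c + t * orientation a b d := by
  obtain rfl : t = 1 - s := by linarith
  simp only [orientation, Prod.fst_add, Prod.snd_add, Prod.smul_fst, Prod.smul_snd, smul_eq_mul]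
  ring

lemma orientation_eq_zero_of_mem_segment {a b p : ℝ × ℝ} (hp : p ∈ segment ℝ a b) :
    orientation a b p = 0 := by
  obtain ⟨s, t, -, -, hst, rfl⟩ := hp
  rw [orientation_combo hst]
  simp only [orientation]; ring

lemma eq_of_mem_segment_of_mem_segment {a b c p : ℝ × ℝ} (h : orientation a b c ≠ 0)
    (hb : p ∈ segment ℝ a b) (hc : p ∈ segment ℝ a c) : p = a := by
  have h0 := orientation_eq_zero_of_mem_segment hb
  obtain ⟨s, t, -, -, hst, rfl⟩ := hc
  rw [orientation_combo hst] at h0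
  have ha : orientation a b a = 0 := by simp [orientation]
  rw [ha, mul_zero, zero_add, mul_eq_zero, or_iff_left h] at h0
  subst h0
  obtain rfl : s = 1 := by linarith
  simp

/-- If `c` and `d` were on the same side of the line `a b`, so would be every point between them,
whereas `p` is on the line. -/
lemma orientation_mul_neg_of_mem_segment {a b c d p : ℝ × ℝ} (hc : orientation a b c ≠ 0)
    (hd : orientation a b d ≠ 0) (hab : p ∈ segment ℝ a b) (hcd : p ∈ segment ℝ c d) :
    orientation a b c * orientation a b d < 0 := by
  have h0 := orientation_eq_zero_of_mem_segment hab
  obtain ⟨s, t, hs, ht, hst, rfl⟩ := hcd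
  rw [orientation_combo hst] at h0
  generalize orientation a b c = x at *
  generalize orientation a b d = y at *
  rcases lt_or_gt_of_ne hc with hx | hx <;> rcases lt_or_gt_of_ne hd with hy | hy
  · nlinarith [mul_nonneg hs (neg_nonneg.2 hx.le), mul_nonneg ht (neg_nonneg.2 hy.le)]
  · exact mul_neg_of_neg_of_pos hx hy
  · exact mul_neg_of_pos_of_neg hx hy
  · nlinarith [mul_nonneg hs hx.le, mul_nonneg ht hy.le]

lemma segment_inter_segment_subsingleton {a b c d : ℝ × ℝ}
    (h : orientation a b c * orientation a b d < 0) :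
    (segment ℝ a b ∩ segment ℝ c d).Subsingleton := by
  rintro p ⟨hp, hp'⟩ q ⟨hq, hq'⟩
  have h1 := orientation_eq_zero_of_mem_segment hp
  have h2 := orientation_eq_zero_of_mem_segment hq
  obtain ⟨s, t, -, -, hst, rfl⟩ := hp'
  obtain ⟨s', t', -, -, hst', rfl⟩ := hq'
  rw [orientation_combo hst] at h1
  rw [orientation_combo hst'] at h2
  have hne : orientation a b c - orientation a b d ≠ 0 := by
    intro h0
    rw [sub_eq_zero.1 h0] at h
    exact absurd h (not_lt.2 (mul_self_nonneg _))
  have hs : (s - s') * (orientation a b c - orientation a b d) = 0 := by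
    obtain rfl : t = 1 - s := by linarith
    obtain rfl : t' = 1 - s' := by linarith
    linear_combination h1 - h2
  rw [mul_eq_zero, or_iff_left hne, sub_eq_zero] at hs
  subst hs
  obtain rfl : t = t' := by linarith
  rfl

/-! ### The rhombicuboctahedron with the diagonals of its quadrilaterals -/

/-- Integer coordinates of the vertices of a Schlegel diagram of the rhombicuboctahedron, with a
corner of its outer triangle at the origin. -/
def schlegel (a : Fin 24) : ℤ × ℤ :=
  [(0, 0), (49, 8), (49, 41), (55, 28), (99, 50), (90, 39), (90, 51), (84, 42), (119, 6), (76, 9),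
    (69, 48), (68, 38), (113, 44), (91, 29), (80, 50), (77, 42), (119, 113), (69, 21), (76, 67),
    (68, 30), (113, 69), (80, 30), (91, 62), (77, 35)].getD a.val (0, 0)

/-- The edges of the rhombicuboctahedron and the diagonals of its quadrilaterals. -/
def gadgetEdges : List (Fin 24 × Fin 24) :=
  [(0, 1), (0, 2), (0, 3), (0, 8), (0, 9), (0, 16), (0, 18), (1, 2), (1, 3), (1, 8), (1, 9),
    (1, 17), (1, 19), (2, 3), (2, 10), (2, 11), (2, 16), (2, 18), (3, 10), (3, 11), (3, 17),
    (3, 19), (4, 5), (4, 6), (4, 7), (4, 12), (4, 13), (4, 20), (4, 22), (5, 6), (5, 7), (5, 12),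
    (5, 13), (5, 21), (5, 23), (6, 7), (6, 14), (6, 15), (6, 20), (6, 22), (7, 14), (7, 15),
    (7, 21), (7, 23), (8, 9), (8, 12), (8, 13), (8, 16), (8, 20), (9, 12), (9, 13), (9, 17),
    (9, 21), (10, 11), (10, 14), (10, 15), (10, 18), (10, 22), (11, 14), (11, 15), (11, 19),
    (11, 23), (12, 13), (12, 16), (12, 20), (13, 17), (13, 21), (14, 15), (14, 18), (14, 22),
    (15, 19), (15, 23), (16, 18), (16, 20), (16, 22), (17, 19), (17, 21), (17, 23), (18, 20),
    (18, 22), (19, 21), (19, 23), (20, 22), (21, 23)]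

/-- The rhombicuboctahedron with both diagonals of all quadrilaterals added: a 7-regular 1-planar
graph on 24 vertices. -/
def gadget : SimpleGraph (Fin 24) where
  Adj a b := (a, b) ∈ gadgetEdges ∨ (b, a) ∈ gadgetEdges
  symm := ⟨fun _ _ h => h.symm⟩
  loopless := ⟨by decide +kernel⟩

instance : DecidableRel gadget.Adj := fun a b =>
  inferInstanceAs (Decidable ((a, b) ∈ gadgetEdges ∨ (b, a) ∈ gadgetEdges))

lemma gadget_degree (a : Fin 24) : gadget.degree a = 7 := by
  revert a; decide +kernel

/-- General position: no edge passes through a third vertex, and edges without a common end can only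
meet in a proper crossing. -/
lemma schlegel_orientation_ne_zero : ∀ a b c : Fin 24, a ≠ b → a ≠ c → b ≠ c →
    orientation (schlegel a) (schlegel b) (schlegel c) ≠ 0 := by
  decide +kernel

/-- The slope bound 19/20 is below 1, so shears by consecutive integers leave a gap between copies.
-/
lemma schlegel_mem_sector : ∀ a : Fin 24,
    0 ≤ (schlegel a).2 ∧ 20 * (schlegel a).2 ≤ 19 * (schlegel a).1 := by
  decide +kernel

/-- The segments spanned by two pairs of vertices of the Schlegel diagram cross properly. -/
def SchlegelCross (e f : Fin 24 × Fin 24) : Prop :=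
  orientation (schlegel e.1) (schlegel e.2) (schlegel f.1) *
    orientation (schlegel e.1) (schlegel e.2) (schlegel f.2) < 0 ∧
  orientation (schlegel f.1) (schlegel f.2) (schlegel e.1) *
    orientation (schlegel f.1) (schlegel f.2) (schlegel e.2) < 0

instance (e f : Fin 24 × Fin 24) : Decidable (SchlegelCross e f) :=
  inferInstanceAs (Decidable (_ ∧ _))

/-- Equality of ordered pairs can be asked for because `gadgetEdges` lists each edge in one
direction only. -/
lemma schlegelCross_unique : ∀ e ∈ gadgetEdges, ∀ f ∈ gadgetEdges, SchlegelCross e f →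
    ∀ g ∈ gadgetEdges, SchlegelCross e g → f = g := by
  decide +kernel

lemma schlegel_injective : Function.Injective schlegel := by
  decide +kernel

/-! ### Gluing copies of the gadget at a common vertex -/

/-- The vertices of `N + 1` copies of the gadget that share the vertex `0`. -/
abbrev BouquetVertex (N : ℕ) : Type := Option (Fin (N + 1) × Fin 23)

/-- The inclusion of the `i`-th copy. -/
def bouquetIncl {N : ℕ} (i : Fin (N + 1)) : Fin 24 → BouquetVertex N :=
  Fin.cases none fun j => some (i, j)

lemma bouquetIncl_injective {N : ℕ} (i : Fin (N + 1)) : Function.Injective (bouquetIncl i) := by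
  intro a b
  cases a using Fin.cases <;> cases b using Fin.cases <;> simp [bouquetIncl]

lemma exists_bouquetIncl_eq {N : ℕ} (v : BouquetVertex N) : ∃ i a, bouquetIncl i a = v := by
  rcases v with _ | ⟨i, j⟩
  · exact ⟨0, 0, rfl⟩
  · exact ⟨i, j.succ, rfl⟩

lemma eq_zero_of_bouquetIncl_eq {N : ℕ} {i j : Fin (N + 1)} {a b : Fin 24}
    (h : bouquetIncl i a = bouquetIncl j b) (hij : i ≠ j) : a = 0 := by
  cases a using Fin.cases <;> cases b using Fin.cases <;> simp_all [bouquetIncl]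

/-- `N + 1` copies of the gadget that share the vertex `0`. -/
def bouquet (N : ℕ) : SimpleGraph (BouquetVertex N) where
  Adj u v := ∃ i a b, gadget.Adj a b ∧ bouquetIncl i a = u ∧ bouquetIncl i b = v
  symm := ⟨by rintro _ _ ⟨i, a, b, h, rfl, rfl⟩; exact ⟨i, b, a, h.symm, rfl, rfl⟩⟩
  loopless := ⟨by
    rintro _ ⟨i, a, b, h, rfl, h'⟩
    exact h.ne (bouquetIncl_injective i h').symm⟩

lemma bouquet_exists_of_mem_edgeSet {N : ℕ} {e : Sym2 (BouquetVertex N)}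
    (he : e ∈ (bouquet N).edgeSet) :
    ∃ i, ∃ p ∈ gadgetEdges, e = s(bouquetIncl i p.1, bouquetIncl i p.2) := by
  induction e with | _ u v =>
  obtain ⟨i, a, b, h | h, rfl, rfl⟩ := he
  · exact ⟨i, (a, b), h, rfl⟩
  · exact ⟨i, (b, a), h, Sym2.eq_swap⟩

lemma bouquet_exists_of_mem {N : ℕ} {e : Sym2 (BouquetVertex N)}
    (he : e ∈ (bouquet N).edgeSet) {w : BouquetVertex N} (hw : w ∈ e) :
    ∃ i a b, gadget.Adj a b ∧ bouquetIncl i a = w ∧ e = s(bouquetIncl i a, bouquetIncl i b) := by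
  induction e with | _ u v =>
  obtain ⟨i, a, b, h, rfl, rfl⟩ := he
  rcases Sym2.mem_iff.1 hw with rfl | rfl
  · exact ⟨i, a, b, h, rfl, rfl⟩
  · exact ⟨i, b, a, h.symm, rfl, Sym2.eq_swap⟩

/-! ### The drawing of the bouquet -/

/-- The position of a vertex in the `i`-th sheared copy of the Schlegel diagram. -/
def shearedPos (i : ℕ) (a : Fin 24) : ℝ × ℝ :=
  ((schlegel a).1, (schlegel a).2 + i * (schlegel a).1)

lemma shearedPos_zero (i : ℕ) : shearedPos i 0 = 0 := by
  simp [shearedPos, schlegel]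

lemma shearedPos_injective (i : ℕ) : Function.Injective (shearedPos i) := by
  intro a b h
  simp only [shearedPos, Prod.mk.injEq, Int.cast_inj] at h
  refine schlegel_injective (Prod.ext h.1 ?_)
  have h2 := h.2
  rw [h.1, add_left_inj] at h2
  exact_mod_cast h2

/-- A shear has determinant 1. -/
lemma orientation_shearedPos (i : ℕ) (a b c : Fin 24) :
    orientation (shearedPos i a) (shearedPos i b) (shearedPos i c) =
      (orientation (schlegel a) (schlegel b) (schlegel c) : ℤ) := by
  simp only [shearedPos, orientation]
  push_cast
  ring

lemma orientation_shearedPos_ne_zero (i : ℕ) {a b c : Fin 24} (hab : a ≠ b) (hac : a ≠ c)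
    (hbc : b ≠ c) : orientation (shearedPos i a) (shearedPos i b) (shearedPos i c) ≠ 0 := by
  rw [orientation_shearedPos, Int.cast_ne_zero]
  exact schlegel_orientation_ne_zero a b c hab hac hbc

/-- The sector of the plane that contains the `i`-th copy of the gadget. -/
def sector (i : ℕ) : Set (ℝ × ℝ) := {p | i * p.1 ≤ p.2 ∧ 20 * p.2 ≤ (20 * i + 19) * p.1}

lemma convex_sector (i : ℕ) : Convex ℝ (sector i) := by
  rintro p ⟨hp, hp'⟩ q ⟨hq, hq'⟩ s t hs ht -
  simp only [sector, Set.mem_ofPred_eq, Prod.fst_add, Prod.snd_add, Prod.smul_fst, Prod.smul_snd,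
    smul_eq_mul]
  constructor
  · linarith [mul_le_mul_of_nonneg_left hp hs, mul_le_mul_of_nonneg_left hq ht]
  · linarith [mul_le_mul_of_nonneg_left hp' hs, mul_le_mul_of_nonneg_left hq' ht]

lemma eq_zero_of_mem_sector_of_lt {i j : ℕ} (hij : i < j) {p : ℝ × ℝ} (hi : p ∈ sector i)
    (hj : p ∈ sector j) : p = 0 := by
  obtain ⟨h1, h2⟩ := hi
  obtain ⟨h3, h4⟩ := hj
  have hij' : (i : ℝ) + 1 ≤ j := by exact_mod_cast hij
  have h0 : 0 ≤ p.1 := by nlinarith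
  -- With x = `p.1` and y = `p.2`, (i + 1)x ≤ jx ≤ y ≤ (i + 19/20)x forces x = 0.
  have h5 := mul_le_mul_of_nonneg_right hij' h0
  have hx : p.1 = 0 := by linarith
  rw [hx] at h1 h2
  exact Prod.ext hx (show p.2 = 0 by linarith)

lemma eq_zero_of_mem_sector {i j : ℕ} (hij : i ≠ j) {p : ℝ × ℝ} (hi : p ∈ sector i)
    (hj : p ∈ sector j) : p = 0 := by
  rcases hij.lt_or_gt with h | h
  · exact eq_zero_of_mem_sector_of_lt h hi hj
  · exact eq_zero_of_mem_sector_of_lt h hj hi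

lemma shearedPos_mem_sector (i : ℕ) (a : Fin 24) : shearedPos i a ∈ sector i := by
  obtain ⟨h1, h2⟩ := schlegel_mem_sector a
  have h1' : (0 : ℝ) ≤ (schlegel a).2 := by exact_mod_cast h1
  have h2' : 20 * ((schlegel a).2 : ℝ) ≤ 19 * (schlegel a).1 := by exact_mod_cast h2
  simp only [sector, shearedPos, Set.mem_ofPred_eq]
  constructor <;> linarith

lemma segment_shearedPos_subset_sector (i : ℕ) (a b : Fin 24) :
    segment ℝ (shearedPos i a) (shearedPos i b) ⊆ sector i :=
  (convex_sector i).segment_subset (shearedPos_mem_sector i a) (shearedPos_mem_sector i b)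

/-- The position of a vertex of the bouquet. -/
def bouquetPos {N : ℕ} : BouquetVertex N → ℝ × ℝ
  | none => 0
  | some (i, j) => shearedPos i j.succ

lemma bouquetPos_incl {N : ℕ} (i : Fin (N + 1)) (a : Fin 24) :
    bouquetPos (bouquetIncl i a) = shearedPos i a := by
  cases a using Fin.cases with
  | zero => exact (shearedPos_zero i).symm
  | succ j => rfl

lemma eq_zero_of_shearedPos_mem_sector {N : ℕ} {i j : Fin (N + 1)} (hij : i ≠ j) {a : Fin 24}
    (h : shearedPos i a ∈ sector j) : a = 0 := by
  have h0 := eq_zero_of_mem_sector (Fin.val_ne_of_ne hij) (shearedPos_mem_sector i a) h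
  exact shearedPos_injective i (h0.trans (shearedPos_zero i).symm)

lemma bouquetPos_injective (N : ℕ) : Function.Injective (bouquetPos (N := N)) := by
  intro u v h
  obtain ⟨i, a, rfl⟩ := exists_bouquetIncl_eq u
  obtain ⟨j, b, rfl⟩ := exists_bouquetIncl_eq v
  rw [bouquetPos_incl, bouquetPos_incl] at h
  by_cases hij : i = j
  · subst hij
    rw [shearedPos_injective i h]
  · obtain rfl := eq_zero_of_shearedPos_mem_sector hij (h ▸ shearedPos_mem_sector j b)
    obtain rfl := eq_zero_of_shearedPos_mem_sector (Ne.symm hij) (h ▸ shearedPos_mem_sector i _)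
    rfl

/-- The straight-line segment that joins two vertices of the bouquet. -/
def bouquetArc {N : ℕ} (e : Sym2 (BouquetVertex N)) : Set (ℝ × ℝ) :=
  Sym2.lift ⟨fun u v => segment ℝ (bouquetPos u) (bouquetPos v), fun _ _ => segment_symm ℝ _ _⟩ e

lemma bouquetArc_incl {N : ℕ} (i : Fin (N + 1)) (a b : Fin 24) :
    bouquetArc s(bouquetIncl i a, bouquetIncl i b) =
      segment ℝ (shearedPos i a) (shearedPos i b) := by
  rw [← bouquetPos_incl, ← bouquetPos_incl]
  rfl

/-- The drawing of the bouquet with straight edges. -/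
def bouquetDrawing (N : ℕ) : PlaneDrawing (bouquet N) where
  pos := bouquetPos
  arc := bouquetArc
  pos_injective := bouquetPos_injective N
  arc_isSimple u v huv :=
    ⟨Path.segment _ _, Path.segment_injective_of_ne ((bouquetPos_injective N).ne huv.ne),
      Path.range_segment _ _⟩
  mem_of_pos_mem_arc e he w hw := by
    obtain ⟨i, ⟨a, b⟩, hab, rfl⟩ := bouquet_exists_of_mem_edgeSet he
    obtain ⟨j, c, rfl⟩ := exists_bouquetIncl_eq w
    rw [bouquetArc_incl, bouquetPos_incl] at hw
    -- A vertex on an arc of copy `i` belongs to that copy: if it comes from another one, it lies in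
    -- both sectors and is the shared vertex.
    obtain ⟨c, hc⟩ : ∃ c', bouquetIncl j c = bouquetIncl i c' := by
      by_cases hij : j = i
      · exact ⟨c, by rw [hij]⟩
      · obtain rfl := eq_zero_of_shearedPos_mem_sector hij
          (segment_shearedPos_subset_sector i a b hw)
        exact ⟨0, rfl⟩
    rw [← bouquetPos_incl j, hc, bouquetPos_incl] at hw
    rw [hc, Sym2.mem_iff, (bouquetIncl_injective i).eq_iff, (bouquetIncl_injective i).eq_iff]
    by_contra! h
    exact orientation_shearedPos_ne_zero i (gadget.ne_of_adj (Or.inl hab)) h.1.symm h.2.symm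
      (orientation_eq_zero_of_mem_segment hw)
  arc_inter_of_adjacent e he f hf hef w hwe hwf := by
    obtain ⟨i, a, b, hab, rfl, rfl⟩ := bouquet_exists_of_mem he hwe
    obtain ⟨j, c, d, hcd, hca, rfl⟩ := bouquet_exists_of_mem hf hwf
    rw [bouquetArc_incl, bouquetArc_incl, bouquetPos_incl]
    have hpos : shearedPos j c = shearedPos i a := by
      rw [← bouquetPos_incl, hca, bouquetPos_incl]
    refine Set.Subset.antisymm ?_ (Set.singleton_subset_iff.2
      ⟨left_mem_segment ℝ _ _, hpos ▸ left_mem_segment ℝ _ _⟩)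
    rintro p ⟨hp, hp'⟩
    rw [Set.mem_singleton_iff]
    by_cases hij : i = j
    · subst hij
      obtain rfl := bouquetIncl_injective i hca
      have hbd : b ≠ d := by rintro rfl; exact hef rfl
      exact eq_of_mem_segment_of_mem_segment
        (orientation_shearedPos_ne_zero i hab.ne hcd.ne hbd) hp hp'
    · rw [eq_zero_of_bouquetIncl_eq hca.symm hij, shearedPos_zero]
      exact eq_zero_of_mem_sector (Fin.val_ne_of_ne hij)
        (segment_shearedPos_subset_sector _ _ _ hp) (segment_shearedPos_subset_sector _ _ _ hp')

/-- Edges with a common end meet only there, and edges of different copies only at the origin; both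
points are vertices. A crossing therefore involves four distinct vertices of one copy, and general
position makes it proper. -/
lemma bouquetDrawing_exists_of_mem_crossings {N : ℕ} {i : Fin (N + 1)} {p : Fin 24 × Fin 24}
    (hp : p ∈ gadgetEdges) {c : Sym2 (BouquetVertex N) × (ℝ × ℝ)}
    (hc : c ∈ (bouquetDrawing N).crossings s(bouquetIncl i p.1, bouquetIncl i p.2)) :
    ∃ q ∈ gadgetEdges, SchlegelCross p q ∧ c.1 = s(bouquetIncl i q.1, bouquetIncl i q.2) ∧
      c.2 ∈ segment ℝ (shearedPos i p.1) (shearedPos i p.2) ∩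
        segment ℝ (shearedPos i q.1) (shearedPos i q.2) := by
  obtain ⟨f, x⟩ := c
  obtain ⟨hf, hne, hxe, hxf, hx⟩ := hc
  dsimp only at hf hne hxe hxf hx
  have he : s(bouquetIncl i p.1, bouquetIncl i p.2) ∈ (bouquet N).edgeSet :=
    ⟨i, p.1, p.2, Or.inl hp, rfl, rfl⟩
  have hdisj : ∀ w, w ∈ s(bouquetIncl i p.1, bouquetIncl i p.2) → w ∉ f := by
    intro w hwe hwf
    have h := (bouquetDrawing N).arc_inter_of_adjacent _ he f hf hne.symm w hwe hwf
    have hxw : x ∈ ({(bouquetDrawing N).pos w} : Set (ℝ × ℝ)) := h ▸ ⟨hxe, hxf⟩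
    exact hx ⟨w, (Set.mem_singleton_iff.1 hxw).symm⟩
  obtain ⟨j, q, hq, rfl⟩ := bouquet_exists_of_mem_edgeSet hf
  replace hxe : x ∈ segment ℝ (shearedPos i p.1) (shearedPos i p.2) :=
    bouquetArc_incl i p.1 p.2 ▸ hxe
  replace hxf : x ∈ segment ℝ (shearedPos j q.1) (shearedPos j q.2) :=
    bouquetArc_incl j q.1 q.2 ▸ hxf
  obtain rfl : i = j := by
    by_contra hij
    refine hx ⟨none, (eq_zero_of_mem_sector (Fin.val_ne_of_ne hij)
      (segment_shearedPos_subset_sector _ _ _ hxe)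
      (segment_shearedPos_subset_sector _ _ _ hxf)).symm⟩
  simp only [Sym2.mem_iff, forall_eq_or_imp, forall_eq, (bouquetIncl_injective i).eq_iff,
    not_or] at hdisj
  obtain ⟨⟨h11, h12⟩, h21, h22⟩ := hdisj
  have hp' : p.1 ≠ p.2 := gadget.ne_of_adj (Or.inl hp)
  have hq' : q.1 ≠ q.2 := gadget.ne_of_adj (Or.inl hq)
  refine ⟨q, hq, ⟨?_, ?_⟩, rfl, hxe, hxf⟩
  · have h := orientation_mul_neg_of_mem_segment (orientation_shearedPos_ne_zero i hp' h11 h21)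
      (orientation_shearedPos_ne_zero i hp' h12 h22) hxe hxf
    rw [orientation_shearedPos, orientation_shearedPos] at h
    exact_mod_cast h
  · have h := orientation_mul_neg_of_mem_segment
      (orientation_shearedPos_ne_zero i hq' (Ne.symm h11) (Ne.symm h12))
      (orientation_shearedPos_ne_zero i hq' (Ne.symm h21) (Ne.symm h22)) hxf hxe
    rw [orientation_shearedPos, orientation_shearedPos] at h
    exact_mod_cast h

lemma isOnePlanar_bouquet (N : ℕ) : IsOnePlanar (bouquet N) := by
  refine ⟨bouquetDrawing N, fun e he => ?_⟩
  obtain ⟨i, p, hp, rfl⟩ := bouquet_exists_of_mem_edgeSet he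
  intro c hc c' hc'
  obtain ⟨q, hq, hpq, h1, h2⟩ := bouquetDrawing_exists_of_mem_crossings hp hc
  obtain ⟨r, hr, hpr, h1', h2'⟩ := bouquetDrawing_exists_of_mem_crossings hp hc'
  obtain rfl := schlegelCross_unique p hp q hq hpq r hr hpr
  refine Prod.ext (h1.trans h1'.symm) (segment_inter_segment_subsingleton ?_ h2 h2')
  rw [orientation_shearedPos, orientation_shearedPos]
  exact_mod_cast hpq.1

/-! ### Degrees and matchings of the bouquet -/

/-- Only a lower bound, since the shared vertex has degree 7(N + 1). -/
lemma seven_le_bouquet_degree {N : ℕ} [DecidableRel (bouquet N).Adj] (v : BouquetVertex N) :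
    7 ≤ (bouquet N).degree v := by
  obtain ⟨i, a, rfl⟩ := exists_bouquetIncl_eq v
  rw [← gadget_degree a, ← card_neighborFinset_eq_degree, ← card_neighborFinset_eq_degree,
    ← Finset.card_image_of_injective _ (bouquetIncl_injective i)]
  refine Finset.card_le_card fun w hw => ?_
  obtain ⟨b, hb, rfl⟩ := Finset.mem_image.1 hw
  rw [mem_neighborFinset] at hb ⊢
  exact ⟨i, a, b, hb, rfl, rfl⟩

lemma bouquet_degree_some_le {N : ℕ} [DecidableRel (bouquet N).Adj] (i : Fin (N + 1))
    (j : Fin 23) : (bouquet N).degree (some (i, j)) ≤ 7 := by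
  rw [← gadget_degree j.succ, ← card_neighborFinset_eq_degree, ← card_neighborFinset_eq_degree,
    ← Finset.card_image_of_injective _ (bouquetIncl_injective i)]
  refine Finset.card_le_card fun w hw => ?_
  rw [mem_neighborFinset] at hw
  obtain ⟨k, a, b, hab, ha, rfl⟩ := hw
  change bouquetIncl k a = bouquetIncl i j.succ at ha
  obtain rfl : k = i := by
    by_contra hk
    exact Fin.succ_ne_zero j (eq_zero_of_bouquetIncl_eq ha.symm (Ne.symm hk))
  obtain rfl := bouquetIncl_injective k ha
  exact Finset.mem_image_of_mem _ ((mem_neighborFinset _ _ _).2 hab)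

lemma minDegree_bouquet (N : ℕ) [DecidableRel (bouquet N).Adj] : (bouquet N).minDegree = 7 :=
  le_antisymm (((bouquet N).minDegree_le_degree _).trans (bouquet_degree_some_le 0 0))
    ((bouquet N).le_minDegree_of_forall_le_degree 7 seven_le_bouquet_degree)

lemma SimpleGraph.Subgraph.IsMatching.eq_of_mem_of_mem {V : Type*} {G : SimpleGraph V}
    {M : G.Subgraph} (hM : M.IsMatching) {e f : Sym2 V} (he : e ∈ M.edgeSet) (hf : f ∈ M.edgeSet)
    {v : V} (hve : v ∈ e) (hvf : v ∈ f) : e = f := by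
  obtain ⟨a, rfl⟩ := hve
  obtain ⟨b, rfl⟩ := hvf
  rw [hM.eq_of_adj_left (Subgraph.mem_edgeSet.1 he) (Subgraph.mem_edgeSet.1 hf)]

lemma SimpleGraph.Subgraph.IsMatching.two_mul_card_le {V : Type*} [DecidableEq V]
    {G : SimpleGraph V} {M : G.Subgraph} (hM : M.IsMatching) {S : Finset (Sym2 V)}
    (hS : (S : Set (Sym2 V)) ⊆ M.edgeSet) {W : Finset V} (hW : ∀ e ∈ S, ∀ v ∈ e, v ∈ W) :
    2 * S.card ≤ W.card := by
  have hcard : (S.biUnion Sym2.toFinset).card = ∑ e ∈ S, e.toFinset.card := by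
    refine Finset.card_biUnion fun e he f hf hef => Finset.disjoint_left.2 fun v hv hv' => ?_
    rw [Sym2.mem_toFinset] at hv hv'
    exact hef (hM.eq_of_mem_of_mem (hS he) (hS hf) hv hv')
  have hsum : ∑ e ∈ S, e.toFinset.card = ∑ _e ∈ S, 2 := Finset.sum_congr rfl fun e he =>
    Sym2.card_toFinset_of_not_isDiag e (G.not_isDiag_of_mem_edgeSet (M.edgeSet_subset (hS he)))
  rw [Finset.sum_const, smul_eq_mul, mul_comm] at hsum
  rw [← hsum, ← hcard]
  refine Finset.card_le_card fun v hv => ?_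
  obtain ⟨e, he, hv⟩ := Finset.mem_biUnion.1 hv
  exact hW e he v (Sym2.mem_toFinset.1 hv)

lemma ncard_edgeSet_le_of_isMatching_bouquet {N : ℕ} {M : (bouquet N).Subgraph}
    (hM : M.IsMatching) : M.edgeSet.ncard ≤ 11 * (N + 1) + 1 := by
  classical
  let E : Finset (Sym2 (BouquetVertex N)) := M.edgeSet.toFinset
  let W : Fin (N + 1) → Finset (BouquetVertex N) := fun i => Finset.univ.image fun j => some (i, j)
  let S : Fin (N + 1) → Finset (Sym2 (BouquetVertex N)) := fun i => {e ∈ E | ∀ v ∈ e, v ∈ W i}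
  let R : Finset (Sym2 (BouquetVertex N)) := {e ∈ E | none ∈ e}
  have hS : ∀ i, (S i).card ≤ 11 := by
    intro i
    have h := hM.two_mul_card_le (S := S i) (W := W i)
      (fun e he => Set.mem_toFinset.1 (Finset.mem_filter.1 he).1)
      (fun e he => (Finset.mem_filter.1 he).2)
    have hW : (W i).card ≤ 23 := Finset.card_image_le.trans (by simp)
    -- Parity enters here: 2 · |S i| ≤ 23 gives |S i| ≤ 11.
    omega
  have hR : R.card ≤ 1 := Finset.card_le_one.2 fun e he f hf => by
    simp only [R, E, Finset.mem_filter, Set.mem_toFinset] at he hf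
    exact hM.eq_of_mem_of_mem he.1 hf.1 he.2 hf.2
  have hsub : E ⊆ Finset.univ.biUnion S ∪ R := by
    intro e he
    obtain ⟨i, ⟨a, b⟩, -, rfl⟩ :=
      bouquet_exists_of_mem_edgeSet (M.edgeSet_subset (Set.mem_toFinset.1 he))
    rw [Finset.mem_union, Finset.mem_biUnion]
    cases a using Fin.cases with
    | zero => exact Or.inr (Finset.mem_filter.2 ⟨he, Sym2.mem_mk_left _ _⟩)
    | succ a =>
      cases b using Fin.cases with
      | zero => exact Or.inr (Finset.mem_filter.2 ⟨he, Sym2.mem_mk_right _ _⟩)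
      | succ b =>
        refine Or.inl ⟨i, Finset.mem_univ _, Finset.mem_filter.2 ⟨he, fun v hv => ?_⟩⟩
        rcases Sym2.mem_iff.1 hv with rfl | rfl <;>
          exact Finset.mem_image_of_mem _ (Finset.mem_univ _)
  have h1 := (Finset.card_le_card hsub).trans (Finset.card_union_le _ _)
  have h2 := Finset.card_biUnion_le_card_mul Finset.univ S 11 fun i _ => hS i
  rw [Finset.card_univ, Fintype.card_fin] at h2
  have h3 : M.edgeSet.ncard = E.card := Set.ncard_eq_toFinset_card' _
  omega

theorem mainTheorem2 (N : ℕ) :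
    ∃ (V : Type) (_ : Fintype V) (G : SimpleGraph V) (_ : DecidableRel G.Adj),
      N ≤ Fintype.card V ∧ IsOnePlanar G ∧ G.minDegree = 7 ∧
        ∀ M : G.Subgraph, M.IsMatching →
          (M.edgeSet.ncard : ℚ) ≤ (11 * (Fintype.card V : ℚ) + 12) / 23 := by
  have hcard : Fintype.card (BouquetVertex N) = 23 * (N + 1) + 1 := by
    simp [mul_comm]
  refine ⟨BouquetVertex N, inferInstance, bouquet N, Classical.decRel _, by omega,
    isOnePlanar_bouquet N, @minDegree_bouquet N (Classical.decRel _), fun M hM => ?_⟩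
  have h : (M.edgeSet.ncard : ℚ) ≤ 11 * (N + 1) + 1 := by
    exact_mod_cast ncard_edgeSet_le_of_isMatching_bouquet hM
  rw [hcard, le_div_iff₀ (by norm_num)]
  push_cast
  linarith
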